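/- A Bratteli diagram $B$ consists of finite vertex sets $V_n$ ($n\ge 0$, $|V_0|=1$) and finite edge sets $E_n$ ($n\ge 1$) with surjective source and range maps $s\colon E_n\to V_{n-1}$ and $r\colon E_n\to V_n$. Its $n$-th incidence matrix $F_n$ ($n\ge 0$) has as $(v,w)$ entry, for $v\in V_{n+1}$ and $w\in V_n$, the number of edges from $w$ to $v$. Let $X_B$ be the space of infinite paths starting in $V_0$, with the topology generated by cylinder sets. $B$ is aperiodic if every class of the tail equivalence relation on $X_B$ (two paths are equivalent if they agree from some level on) is infinite. An ordering $\omega$ on $B$ is a choice of a linear order on $r^{-1}(v)$ for every $v\in\bigcup_{n\ge1}V_n$; an infinite path is maximal (minimal) if each of its edges $e$ is the largest (smallest) element of $r^{-1}(r(e))$. The ordering $\omega$ is perfect if it admits a Vershik map, i.e. a homeomorphism $\varphi$ of $X_B$ which maps the set of maximal paths onto the set of minimal paths and which sends each non-maximal path $x=(x_1,x_2,\dots)$ to $(y_1,\dots,y_{m-1},\overline{x_m},x_{m+1},x_{m+2},\dots)$, where $m$ is the least index such that $x_m$ is not the largest edge of $r^{-1}(r(x_m))$, $\overline{x_m}$ is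 the successor of $x_m$ in $r^{-1}(r(x_m))$, and $(y_1,\dots,y_{m-1})$ is the path from $V_0$ to $s(\overline{x_m})$ all of whose edges are minimal. The diagram $B$ belongs to the class $\mathcal A$ with $k$ minimal components if, for a suitable labelling of the vertices of each level $n\ge1$ by a fixed finite set, its incidence matrices have the form $$F_n=\begin{pmatrix}A_n^{(1)}&0&\cdots&0&0\\ 0&A_n^{(2)}&\cdots&0&0\\ \vdots&\vdots&\ddots&\vdots&\vdots\\ 0&0&\cdots&A_n^{(k)}&0\\ B_n^{(1)}&B_n^{(2)}&\cdots&B_n^{(k)}&C_n\end{pmatrix},\qquad n\ge1,$$ where, for some integers $d_1,\dots,d_k\ge1$ and $s\ge1$ independent of $n$, $A_n^{(i)}$ is $d_i\times d_i$, $B_n^{(i)}$ is $s\times d_i$, $C_n$ is $s\times s$, and all entries of the matrices $A_n^{(i)}$, $B_n^{(i)}$, $C_n$ are strictly positive (so that the rows of the last block of $F_n$ are strictly positive for every $n\ge1$). Proposition. Let $B$ be an aperiodic Bratteli diagram in the class $\mathcal A$ with $k$ minimal components, such that $C_n$ is an $s\times s$ matrix for every $n\ge1$, where $1\le s\le k-1$.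 If $k>2$, then there is no perfect ordering on $B$. If $k=2$ and there is a perfect ordering on $B$, then $C_n=(1)$ (the $1\times1$ matrix with entry $1$) for all but finitely many $n$. -/

import Mathlib

universe u

/-- A Bratteli diagram. `V n` is the set of vertices of level `n`, and `E n` is the set of edges
between the levels `n` and `n + 1` (so `E n` is the edge set usually written `E_{n+1}`). -/
structure BratteliDiagram where
  V : ℕ → Type u
  E : ℕ → Type u
  src : ∀ {n : ℕ}, E n → V n
  rng : ∀ {n : ℕ}, E n → V (n + 1)
  card_zero : Nat.card (V 0) = 1
  finite_V : ∀ n, Finite (V n)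
  finite_E : ∀ n, Finite (E n)
  src_surjective : ∀ n, Function.Surjective (src (n := n))
  rng_surjective : ∀ n, Function.Surjective (rng (n := n))

namespace BratteliDiagram

/-- The `n`-th incidence matrix: the `(v, w)` entry is the number of edges from `w` (level `n`)
to `v` (level `n + 1`). -/
noncomputable def incidence (B : BratteliDiagram) (n : ℕ) :
    Matrix (B.V (n + 1)) (B.V n) ℕ :=
  fun v w => Nat.card {e : B.E n // B.rng e = v ∧ B.src e = w}

/-- The space of infinite paths starting at the top vertex. -/
def PathSpace (B : BratteliDiagram) :=
  {x : ∀ n, B.E n // ∀ n, B.rng (x n) = B.src (x (n + 1))}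

/-- The `n`-th edge of an infinite path, counted from `0`. -/
def PathSpace.edge {B : BratteliDiagram} (x : B.PathSpace) (n : ℕ) : B.E n := x.1 n

/-- The topology generated by the cylinder sets, that is, the subspace topology of the product
of the discrete finite sets of edges. -/
instance (B : BratteliDiagram) : TopologicalSpace B.PathSpace :=
  TopologicalSpace.induced (fun x n => x.edge n) (@Pi.topologicalSpace ℕ B.E (fun _ => ⊥))

/-- Tail (cofinal) equivalence of infinite paths. -/
def TailEquiv {B : BratteliDiagram} (x y : B.PathSpace) : Prop :=
  ∃ N, ∀ n, N ≤ n → x.edge n = y.edge n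

/-- A diagram is aperiodic if every tail equivalence class is infinite. -/
def Aperiodic (B : BratteliDiagram) : Prop :=
  ∀ x : B.PathSpace, {y : B.PathSpace | TailEquiv x y}.Infinite

/-- An ordering on a diagram: a partial order on the edges for which two edges are comparable
exactly when they have the same range, that is, a linear order on each set `r⁻¹(v)`. -/
structure EdgeOrdering (B : BratteliDiagram) where
  le : ∀ {n : ℕ}, B.E n → B.E n → Prop
  comparable_iff : ∀ {n : ℕ} (e f : B.E n), (le e f ∨ le f e) ↔ B.rng e = B.rng f
  le_antisymm : ∀ {n : ℕ} (e f : B.E n), le e f → le f e → e = f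
  le_trans : ∀ {n : ℕ} (e f g : B.E n), le e f → le f g → le e g

namespace EdgeOrdering

variable {B : BratteliDiagram} (ω : B.EdgeOrdering)

/-- `e` is the largest edge with its range. -/
def IsMaxEdge {n : ℕ} (e : B.E n) : Prop := ∀ f : B.E n, B.rng f = B.rng e → ω.le f e

/-- `e` is the smallest edge with its range. -/
def IsMinEdge {n : ℕ} (e : B.E n) : Prop := ∀ f : B.E n, B.rng f = B.rng e → ω.le e f

/-- `f` is the successor of `e` among the edges with the same range as `e`. -/
def IsSuccEdge {n : ℕ} (e f : B.E n) : Prop :=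
  ω.le e f ∧ f ≠ e ∧ ∀ g : B.E n, ω.le e g → g ≠ e → ω.le f g

/-- The set of maximal infinite paths. -/
def maxPaths : Set B.PathSpace := {x | ∀ n, ω.IsMaxEdge (x.edge n)}

/-- The set of minimal infinite paths. -/
def minPaths : Set B.PathSpace := {x | ∀ n, ω.IsMinEdge (x.edge n)}

/-- `φ` is a Vershik map for the ordering: a homeomorphism of the path space that maps the
maximal paths onto the minimal paths and that, at a path `x` whose first non-maximal edge is the
edge number `m`, replaces this edge by its successor, replaces the edges before it by minimal
edges, and keeps the edges after it. -/
structure IsVershikMap (φ : B.PathSpace ≃ₜ B.PathSpace) : Prop where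
  image_maxPaths : φ '' ω.maxPaths = ω.minPaths
  apply_of_not_max : ∀ (x : B.PathSpace) (m : ℕ),
    (∀ i, i < m → ω.IsMaxEdge (x.edge i)) → ¬ ω.IsMaxEdge (x.edge m) →
      (∀ i, i < m → ω.IsMinEdge ((φ x).edge i)) ∧
      ω.IsSuccEdge (x.edge m) ((φ x).edge m) ∧
      ∀ i, m < i → (φ x).edge i = x.edge i

/-- An ordering is perfect if it admits a Vershik map. -/
def IsPerfect : Prop := ∃ φ : B.PathSpace ≃ₜ B.PathSpace, ω.IsVershikMap φ

end EdgeOrdering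

/-- Membership of the diagram in the class `𝒜` with `k` minimal components and bottom block of
size `s`: after the vertices of each level `n + 1` are labelled by a fixed index set, the
incidence matrix `F_{n+1}` between the levels `n + 1` and `n + 2` is

  `diag(A_{n+1}⁽¹⁾, …, A_{n+1}⁽ᵏ⁾)   0`
  `(B_{n+1}⁽¹⁾ ⋯ B_{n+1}⁽ᵏ⁾)   C_{n+1}`

with positive blocks. Here `blockA n i`, `blockB n i`, `blockC n` are the blocks of `F_{n+1}`,
so that `n = 0, 1, 2, …` runs through all incidence matrices but the very first one. -/
structure FamilyA (B : BratteliDiagram) (k s : ℕ) where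
  d : Fin k → ℕ
  d_pos : ∀ i, 0 < d i
  label : ∀ n, B.V (n + 1) ≃ ((i : Fin k) × Fin (d i)) ⊕ Fin s
  blockA : ℕ → ∀ i : Fin k, Matrix (Fin (d i)) (Fin (d i)) ℕ
  blockB : ℕ → ∀ i : Fin k, Matrix (Fin s) (Fin (d i)) ℕ
  blockC : ℕ → Matrix (Fin s) (Fin s) ℕ
  incidence_eq : ∀ n,
    Matrix.reindex (label (n + 1)) (label n) (B.incidence (n + 1)) =
      Matrix.fromBlocks (Matrix.blockDiagonal' (blockA n)) 0
        (Matrix.of fun c p => blockB n p.1 c p.2) (blockC n)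
  blockA_pos : ∀ n i a b, 0 < blockA n i a b
  blockB_pos : ∀ n i c b, 0 < blockB n i c b
  blockC_pos : ∀ n c c', 0 < blockC n c c'
  exists_pos_row : ∃ c : Fin s, ∀ n w,
    0 < Matrix.reindex (label (n + 1)) (label n) (B.incidence (n + 1)) (Sum.inr c) w

end BratteliDiagram

/-! Read the ordered edges into a vertex as a word in the labels of their sources. Fix an
ultrafilter on the levels that refines `atTop`. The finite maximal (minimal) paths to the vertices
labelled `t` converge along it to a path `M t` (`m t`), and continuity of a Vershik map `φ` gives `φ
(M t) = m t'` whenever `t'` follows `t` in a word at almost all levels (`eventually_apply_limit`).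
By aperiodicity `φ` and its inverse preserve the set `Z j` of paths in the `j`-th component
(`mem_Z`, `mem_Z_of_apply`), and `M t`, `m t` lie in `Z j` when `t` belongs to component `j`.

As `s < k`, some `Z j₀` contains no `M t` with `t` at the bottom. A letter of component `j₀` can
then only be preceded by letters of that component, so every bottom word begins in it
(`eventually_comp_first`). One level up, all bottom minimal limits therefore lie in `Z j₀`
(`exists_component`), so a letter of a component `j ≠ j₀` is followed only by letters of `j`
(`eventually_comp_of_le`).

Bottom words contain letters of every component, so two components besides `j₀` are impossible and
`k ≤ 2`. If `k = 2`, the bottom maximal limit lies in the component other than `j₀`; after a bottom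
letter everything is in that component, so the bottom letter occurs only once and `C_n = 1`. -/

open Filter Topology

namespace BratteliDiagram

variable {B : BratteliDiagram.{u}}

/-! ### Convergence and splicing of paths -/

namespace PathSpace

@[ext]
theorem ext_edge {x y : B.PathSpace} (h : ∀ n, x.edge n = y.edge n) : x = y :=
  Subtype.ext (funext h)

theorem rng_edge (x : B.PathSpace) (n : ℕ) : B.rng (x.edge n) = B.src (x.edge (n + 1)) := x.2 n

/-- Convergence of paths is convergence of every edge. -/
theorem tendsto_nhds_iff {ι : Type*} {l : Filter ι} {a : ι → B.PathSpace} {x : B.PathSpace} :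
    Tendsto a l (𝓝 x) ↔ ∀ i, ∀ᶠ n in l, (a n).edge i = x.edge i := by
  let (n : ℕ) : TopologicalSpace (B.E n) := ⊥
  have (n : ℕ) : DiscreteTopology (B.E n) := ⟨rfl⟩
  rw [nhds_induced, tendsto_comap_iff, tendsto_pi_nhds]
  simp only [nhds_discrete, tendsto_pure, Function.comp_apply]

/-- Along an ultrafilter every family of paths converges. -/
theorem exists_limit {ι : Type*} (W : Ultrafilter ι) (a : ι → B.PathSpace) :
    ∃ x : B.PathSpace, ∀ i, ∀ᶠ n in (W : Filter ι), (a n).edge i = x.edge i := by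
  have h (i : ℕ) : ∃ e : B.E i, ∀ᶠ n in (W : Filter ι), (a n).edge i = e := by
    have := B.finite_E i
    obtain ⟨e, he⟩ := Ultrafilter.eq_pure_of_finite (W.map fun n => (a n).edge i)
    refine ⟨e, ?_⟩
    have : {e} ∈ W.map fun n => (a n).edge i := by rw [he]; exact Set.mem_singleton e
    exact this
  choose e he using h
  refine ⟨⟨e, fun i => ?_⟩, he⟩
  obtain ⟨n, h₁, h₂⟩ := ((he i).and (he (i + 1))).exists
  rw [← h₁, ← h₂, rng_edge]

end PathSpace

/-- Every edge continues to an infinite sequence of composable edges; the edges below it are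
arbitrary. -/
theorem exists_tail (n : ℕ) (e : B.E n) :
    ∃ y : ∀ i, B.E i, y n = e ∧ ∀ i, n ≤ i → B.rng (y i) = B.src (y (i + 1)) := by
  have hne : ∀ i, Nonempty (B.V i) := by
    intro i
    induction i with
    | zero => exact (Nat.card_pos_iff.mp (by rw [B.card_zero]; exact one_pos)).1
    | succ i ih =>
      obtain ⟨v⟩ := ih
      obtain ⟨f, -⟩ := B.src_surjective i v
      exact ⟨B.rng f⟩
  choose out hout using B.src_surjective
  let b : ∀ i, B.E i := Function.update (fun i => out i (hne i).some) n e
  have hb : b n = e := Function.update_self ..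
  let y : ∀ i, B.E i := fun i =>
    Nat.rec (b 0) (fun i f => if n ≤ i then out (i + 1) (B.rng f) else b (i + 1)) i
  refine ⟨y, ?_, fun i hi => ?_⟩
  · rw [← hb]
    cases n with
    | zero => rfl
    | succ m => exact if_neg (by omega)
  · have : y (i + 1) = out (i + 1) (B.rng (y i)) := if_pos hi
    rw [this, hout]

/-- A sequence of edges composable from level `n` on can be altered below `n` to a path whose
edges below `n` have a property which holds for some edge into every vertex. -/
theorem exists_path_of_tail (Q : ∀ n, B.E n → Prop)
    (hQ : ∀ n (v : B.V (n + 1)), ∃ e : B.E n, B.rng e = v ∧ Q n e) (n : ℕ) :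
    ∀ y : ∀ i, B.E i, (∀ i, n ≤ i → B.rng (y i) = B.src (y (i + 1))) →
      ∃ x : B.PathSpace, (∀ i, n ≤ i → x.edge i = y i) ∧ ∀ i, i < n → Q i (x.edge i) := by
  induction n with
  | zero => exact fun y hy => ⟨⟨y, fun i => hy i i.zero_le⟩, fun _ _ => rfl, fun i hi => by omega⟩
  | succ n ih =>
    intro y hy
    obtain ⟨e, he, hQe⟩ := hQ n (B.src (y (n + 1)))
    obtain ⟨x, hx, hxQ⟩ := ih (Function.update y n e) fun i hi => by
      rw [Function.update_of_ne (show i + 1 ≠ n by omega)]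
      rcases hi.eq_or_lt with rfl | hi
      · rw [Function.update_self, he]
      · rw [Function.update_of_ne hi.ne', hy i hi]
    refine ⟨x, fun i hi => ?_, fun i hi => ?_⟩
    · rw [hx i (by omega), Function.update_of_ne (by omega)]
    · rcases (Nat.lt_succ_iff.mp hi).eq_or_lt with rfl | hi
      · rw [hx i le_rfl, Function.update_self]
        exact hQe
      · exact hxQ i hi

theorem exists_path_through (Q : ∀ n, B.E n → Prop)
    (hQ : ∀ n (v : B.V (n + 1)), ∃ e : B.E n, B.rng e = v ∧ Q n e) (n : ℕ) (e : B.E n) :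
    ∃ x : B.PathSpace, x.edge n = e ∧ ∀ i, i < n → Q i (x.edge i) := by
  obtain ⟨y, hy, hy'⟩ := exists_tail n e
  obtain ⟨x, hx, hx'⟩ := exists_path_of_tail Q hQ n y hy'
  exact ⟨x, (hx n le_rfl).trans hy, hx'⟩

/-- Paths with edges of a property that determines the edge by its range agree below a level at
which they meet. -/
theorem edge_eq_of_meet (Q : ∀ n, B.E n → Prop)
    (hQ : ∀ n (e f : B.E n), Q n e → Q n f → B.rng e = B.rng f → e = f) (n : ℕ)
    (x y : B.PathSpace) (h : B.src (x.edge n) = B.src (y.edge n))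
    (hx : ∀ i, i < n → Q i (x.edge i)) (hy : ∀ i, i < n → Q i (y.edge i)) :
    ∀ i, i < n → x.edge i = y.edge i := by
  induction n with
  | zero => intro i hi; omega
  | succ n ih =>
    have hn : x.edge n = y.edge n := hQ n _ _ (hx n n.lt_succ_self) (hy n n.lt_succ_self)
      (by rw [x.rng_edge, y.rng_edge, h])
    intro i hi
    rcases (Nat.lt_succ_iff.mp hi).eq_or_lt with rfl | hi
    · exact hn
    · exact ih (by rw [hn]) (fun i hi => hx i (by omega)) (fun i hi => hy i (by omega)) i hi

/-! ### Finite linear orders on the edges into a vertex -/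

namespace EdgeOrdering

variable (ω : B.EdgeOrdering)

theorem le_refl {n : ℕ} (e : B.E n) : ω.le e e := by simpa using (ω.comparable_iff e e).mpr rfl

theorem rng_eq_of_le {n : ℕ} {e f : B.E n} (h : ω.le e f) : B.rng e = B.rng f :=
  (ω.comparable_iff e f).mp (Or.inl h)

theorem eq_of_isMaxEdge {n : ℕ} {e f : B.E n} (he : ω.IsMaxEdge e) (hf : ω.IsMaxEdge f)
    (h : B.rng e = B.rng f) : e = f :=
  ω.le_antisymm e f (hf e h) (he f h.symm)

theorem eq_of_isMinEdge {n : ℕ} {e f : B.E n} (he : ω.IsMinEdge e) (hf : ω.IsMinEdge f)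
    (h : B.rng e = B.rng f) : e = f :=
  ω.le_antisymm e f (he f h.symm) (hf e h)

theorem IsSuccEdge.right_unique {n : ℕ} {e f g : B.E n} (hf : ω.IsSuccEdge e f)
    (hg : ω.IsSuccEdge e g) : f = g :=
  ω.le_antisymm f g (hf.2.2 g hg.1 hg.2.1) (hg.2.2 f hf.1 hf.2.1)

theorem IsSuccEdge.not_isMaxEdge {n : ℕ} {e f : B.E n} (h : ω.IsSuccEdge e f) :
    ¬ ω.IsMaxEdge e := fun he =>
  h.2.1 (ω.le_antisymm f e (he f (ω.rng_eq_of_le h.1).symm) h.1)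

/-- A nonempty set of edges with the same range has a smallest element. -/
theorem exists_least {n : ℕ} (S : Set (B.E n)) (hS : S.Nonempty)
    (h : ∀ e ∈ S, ∀ f ∈ S, B.rng e = B.rng f) : ∃ e ∈ S, ∀ f ∈ S, ω.le e f := by
  have := B.finite_E n
  let : Preorder (B.E n) :=
    { le := ω.le, le_refl := ω.le_refl, le_trans := ω.le_trans }
  obtain ⟨e, he⟩ := S.toFinite.exists_minimal hS
  exact ⟨e, he.1, fun f hf => ((ω.comparable_iff e f).mpr (h e he.1 f hf)).elim id (he.2 hf)⟩

/-- A nonempty set of edges with the same range has a largest element. -/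
theorem exists_greatest {n : ℕ} (S : Set (B.E n)) (hS : S.Nonempty)
    (h : ∀ e ∈ S, ∀ f ∈ S, B.rng e = B.rng f) : ∃ e ∈ S, ∀ f ∈ S, ω.le f e := by
  have := B.finite_E n
  let : Preorder (B.E n) :=
    { le := ω.le, le_refl := ω.le_refl, le_trans := ω.le_trans }
  obtain ⟨e, he⟩ := S.toFinite.exists_maximal hS
  exact ⟨e, he.1, fun f hf => ((ω.comparable_iff f e).mpr (h f hf e he.1)).elim id (he.2 hf)⟩

theorem exists_isMinEdge (n : ℕ) (v : B.V (n + 1)) : ∃ e : B.E n, B.rng e = v ∧ ω.IsMinEdge e := by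
  obtain ⟨e, he, h⟩ := ω.exists_least {e : B.E n | B.rng e = v} (B.rng_surjective n v)
    fun e he f hf => he.trans hf.symm
  exact ⟨e, he, fun f hf => h f (hf.trans he)⟩

theorem exists_isMaxEdge (n : ℕ) (v : B.V (n + 1)) : ∃ e : B.E n, B.rng e = v ∧ ω.IsMaxEdge e := by
  obtain ⟨e, he, h⟩ := ω.exists_greatest {e : B.E n | B.rng e = v} (B.rng_surjective n v)
    fun e he f hf => he.trans hf.symm
  exact ⟨e, he, fun f hf => h f (hf.trans he)⟩

/-- Induction along successors, upwards from an edge. -/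
theorem succ_induction {n : ℕ} {e : B.E n} {P : B.E n → Prop} (base : P e)
    (step : ∀ g f, ω.le e g → ω.IsSuccEdge g f → P g → P f) {g : B.E n} (hg : ω.le e g) : P g := by
  by_contra hP
  obtain ⟨f, ⟨hef, hPf⟩, hmin⟩ := ω.exists_least {f | ω.le e f ∧ ¬ P f} ⟨g, hg, hP⟩
    fun a ha b hb => (ω.rng_eq_of_le ha.1).symm.trans (ω.rng_eq_of_le hb.1)
  have hne : e ≠ f := fun h => hPf (h ▸ base)
  -- `f` is the least counterexample and `p` its immediate predecessor.
  obtain ⟨p, ⟨hep, hpf, hpne⟩, hmax⟩ := ω.exists_greatest {p | ω.le e p ∧ ω.le p f ∧ p ≠ f}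
    ⟨e, ω.le_refl e, hef, hne⟩
    fun a ha b hb => (ω.rng_eq_of_le ha.1).symm.trans (ω.rng_eq_of_le hb.1)
  have hsucc : ω.IsSuccEdge p f := by
    refine ⟨hpf, hpne.symm, fun q hpq hqp => ?_⟩
    have hr : B.rng f = B.rng q := (ω.rng_eq_of_le hpf).symm.trans (ω.rng_eq_of_le hpq)
    refine ((ω.comparable_iff f q).mpr hr).elim id fun hqf => ?_
    by_cases hq : q = f
    · exact hq ▸ ω.le_refl f
    · exact absurd (ω.le_antisymm q p (hmax q ⟨ω.le_trans _ _ _ hep hpq, hqf, hq⟩) hpq) hqp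
  refine hPf (step p f hep hsucc ?_)
  by_contra hPp
  exact hpne (ω.le_antisymm p f hpf (hmin p ⟨hep, hPp⟩))

end EdgeOrdering

/-! ### Block structure and the minimal components -/

namespace FamilyA

variable {k s : ℕ} (D : B.FamilyA k s)

/-- The minimal component that contains a vertex, if it is not in the bottom block. -/
def comp (n : ℕ) (v : B.V (n + 1)) : Option (Fin k) :=
  Sum.elim (fun p => some p.1) (fun _ => none) (D.label n v)

theorem incidence_label (n : ℕ) (v : B.V (n + 2)) (w : B.V (n + 1)) :
    B.incidence (n + 1) v w = Matrix.fromBlocks (Matrix.blockDiagonal' (D.blockA n)) 0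
        (Matrix.of fun c p => D.blockB n p.1 c p.2) (D.blockC n)
        (D.label (n + 1) v) (D.label n w) := by
  rw [← D.incidence_eq n]
  simp

theorem incidence_pos_of_edge {n : ℕ} (e : B.E n) : 0 < B.incidence n (B.rng e) (B.src e) := by
  have := B.finite_E n
  exact Nat.card_pos_iff.mpr ⟨⟨⟨e, rfl, rfl⟩⟩, inferInstance⟩

theorem exists_edge_of_incidence_pos {n : ℕ} {v : B.V (n + 1)} {w : B.V n}
    (h : 0 < B.incidence n v w) : ∃ e : B.E n, B.rng e = v ∧ B.src e = w := by
  obtain ⟨⟨e, he⟩⟩ := (Nat.card_pos_iff.mp h).1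
  exact ⟨e, he⟩

/-- The zero blocks of `F_n` leave a component vertex no incoming edges from elsewhere; hence
components can be left downwards but never entered. -/
theorem comp_src_of_comp_rng {n : ℕ} {j : Fin k} (e : B.E (n + 1))
    (h : D.comp (n + 1) (B.rng e) = some j) : D.comp n (B.src e) = some j := by
  have hpos := incidence_pos_of_edge e
  rw [D.incidence_label] at hpos
  unfold comp at h ⊢
  generalize D.label (n + 1) (B.rng e) = t at h hpos
  generalize D.label n (B.src e) = t' at hpos ⊢
  rcases t with ⟨i, a⟩ | c <;> rcases t' with ⟨i', a'⟩ | c' <;> simp_all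
  by_contra hne
  exact hpos.ne' (Matrix.blockDiagonal'_apply_ne (D.blockA n) a a'
    fun hi => hne (hi.symm.trans h))

theorem exists_edge_of_comp {n : ℕ} {j : Fin k} {v : B.V (n + 2)} {w : B.V (n + 1)}
    (hv : D.comp (n + 1) v = some j) (hw : D.comp n w = some j) :
    ∃ e : B.E (n + 1), B.rng e = v ∧ B.src e = w := by
  refine exists_edge_of_incidence_pos ?_
  rw [D.incidence_label]
  unfold comp at hv hw
  generalize D.label (n + 1) v = t at hv ⊢
  generalize D.label n w = t' at hw ⊢
  rcases t with ⟨i, a⟩ | c <;> rcases t' with ⟨i', a'⟩ | c' <;> simp_all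
  subst hv
  subst hw
  exact (D.blockA_pos n _ a a').trans_eq (Matrix.blockDiagonal'_apply_eq (D.blockA n) _ a a').symm

theorem exists_edge_of_bottom {n : ℕ} {c : Fin s} {v : B.V (n + 2)}
    (hv : D.label (n + 1) v = Sum.inr c) (w : B.V (n + 1)) :
    ∃ e : B.E (n + 1), B.rng e = v ∧ B.src e = w := by
  refine exists_edge_of_incidence_pos ?_
  rw [D.incidence_label, hv]
  rcases D.label n w with ⟨i, a⟩ | c'
  · exact D.blockB_pos ..
  · exact D.blockC_pos ..

theorem exists_edge_of_bottom_of_comp {n : ℕ} {c : Fin s} {v : B.V (n + 2)}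
    (hv : D.label (n + 1) v = Sum.inr c) (j : Fin k) :
    ∃ e : B.E (n + 1), B.rng e = v ∧ D.comp n (B.src e) = some j := by
  obtain ⟨e, he, hs⟩ := D.exists_edge_of_bottom hv ((D.label n).symm (Sum.inl ⟨j, 0, D.d_pos j⟩))
  exact ⟨e, he, by rw [hs]; simp [comp]⟩

/-- The paths that stay in the `j`-th minimal component. -/
def Z (j : Fin k) : Set B.PathSpace := {x | ∀ n, D.comp n (B.src (x.edge (n + 1))) = some j}

variable {D}

theorem comp_of_le {x : B.PathSpace} {j : Fin k} {m n : ℕ} (hmn : m ≤ n)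
    (h : D.comp n (B.src (x.edge (n + 1))) = some j) :
    D.comp m (B.src (x.edge (m + 1))) = some j := by
  induction hmn with
  | refl => exact h
  | @step n _ ih => exact ih (D.comp_src_of_comp_rng _ (by rw [x.rng_edge]; exact h))

theorem mem_Z_of_frequently {x : B.PathSpace} {j : Fin k}
    (h : ∀ m, ∃ n, m ≤ n ∧ D.comp n (B.src (x.edge (n + 1))) = some j) : x ∈ D.Z j := fun m => by
  obtain ⟨n, hmn, hn⟩ := h m
  exact comp_of_le hmn hn

theorem Z_disjoint {x : B.PathSpace} {i j : Fin k} (hi : x ∈ D.Z i) (hj : x ∈ D.Z j) : i = j :=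
  Option.some_injective _ ((hi 0).symm.trans (hj 0))

theorem mem_Z_of_tailEquiv {x y : B.PathSpace} {j : Fin k} (h : TailEquiv x y) (hx : x ∈ D.Z j) :
    y ∈ D.Z j := by
  obtain ⟨N, hN⟩ := h
  refine mem_Z_of_frequently fun m => ⟨max m N, le_max_left .., ?_⟩
  rw [← hN _ (by omega)]
  exact hx _

theorem mem_Z_of_tendsto {ι : Type*} {l : Filter ι} [l.NeBot] {a : ι → B.PathSpace}
    {x : B.PathSpace} {j : Fin k} (h : Tendsto a l (𝓝 x)) (ha : ∀ n, a n ∈ D.Z j) :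
    x ∈ D.Z j := fun m => by
  obtain ⟨n, hn⟩ := (PathSpace.tendsto_nhds_iff.mp h (m + 1)).exists
  rw [← hn]
  exact ha n m

/-- In an aperiodic diagram, a path of a minimal component is approximated by paths of the
component which have an edge that competes with an edge of the given path. -/
theorem exists_near (hB : B.Aperiodic) {x : B.PathSpace} {j : Fin k} (hx : x ∈ D.Z j) (n : ℕ) :
    ∃ z ∈ D.Z j, (∀ i, i < n → z.edge i = x.edge i) ∧
      ∃ m, B.rng (z.edge m) = B.rng (x.edge m) ∧ z.edge m ≠ x.edge m := by
  -- Only finitely many paths agree with `x` beyond level `n + 1`, so the infinite tail class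
  -- contains a `y` that differs from `x` later.
  have hfin : {y : B.PathSpace | ∀ i, n + 1 < i → x.edge i = y.edge i}.Finite := by
    have := B.finite_E
    refine Set.Finite.of_injOn (f := fun y (i : Fin (n + 2)) => y.edge i)
      (t := (Set.univ : Set (∀ i : Fin (n + 2), B.E i))) (fun _ _ => Set.mem_univ _)
      (fun y hy y' hy' h => ?_) Set.finite_univ
    ext i
    by_cases hi : n + 1 < i
    · rw [← hy i hi, ← hy' i hi]
    · exact congrFun h ⟨i, by omega⟩
  obtain ⟨y, hxy, hy⟩ := (hB x).exists_notMem_finite hfin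
  have hyZ : y ∈ D.Z j := mem_Z_of_tailEquiv hxy hx
  classical
  obtain ⟨m, hnm, hm, hne⟩ : ∃ m, n + 1 < m ∧ B.rng (y.edge m) = B.rng (x.edge m) ∧
      y.edge m ≠ x.edge m := by
    let N := Nat.find hxy
    have hN : ∀ i, N ≤ i → x.edge i = y.edge i := Nat.find_spec hxy
    have hlt : n + 2 < N := by
      by_contra hle
      exact hy fun i hi => hN i (by omega)
    -- At the last difference of `x` and `y` the two edges have the same range.
    refine ⟨N - 1, by omega, ?_, fun h => ?_⟩
    · rw [y.rng_edge, x.rng_edge, hN (N - 1 + 1) (by omega)]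
    · refine Nat.find_min hxy (show N - 1 < N by omega) fun i hi => ?_
      rcases hi.eq_or_lt with rfl | hi
      · exact h.symm
      · exact hN i (by omega)
  -- Positivity of the block `A` provides a bridge from `x` to `y`.
  obtain ⟨e, hr, hs⟩ := D.exists_edge_of_comp (hyZ (n + 1)) (hx n)
  let f : ∀ i, B.E i := Function.update (fun i => if i < n + 1 then x.edge i else y.edge i) (n + 1) e
  have hfx (i : ℕ) (hi : i < n + 1) : f i = x.edge i := by
    simp only [f]
    rw [Function.update_of_ne hi.ne, if_pos hi]
  have hfe : f (n + 1) = e := Function.update_self ..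
  have hfy (i : ℕ) (hi : n + 1 < i) : f i = y.edge i := by
    simp only [f]
    rw [Function.update_of_ne hi.ne', if_neg hi.not_gt]
  have hf (i : ℕ) : B.rng (f i) = B.src (f (i + 1)) := by
    rcases lt_trichotomy i n with hi | rfl | hi
    · rw [hfx i (by omega), hfx (i + 1) (by omega), x.rng_edge]
    · rw [hfx i (by omega), hfe, x.rng_edge, hs]
    · rw [hfy (i + 1) (by omega)]
      rcases (show n + 1 ≤ i from hi).eq_or_lt with rfl | hi
      · rw [hfe, hr]
      · rw [hfy i hi, y.rng_edge]
  let z : B.PathSpace := ⟨f, hf⟩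
  refine ⟨z, mem_Z_of_tailEquiv ⟨n + 2, fun i hi => (hfy i hi).symm⟩ hyZ,
    fun i hi => hfx i (by omega), m, ?_⟩
  rw [show z.edge m = y.edge m from hfy m hnm]
  exact ⟨hm, hne⟩

theorem exists_seq_near (hB : B.Aperiodic) {x : B.PathSpace} {j : Fin k} (hx : x ∈ D.Z j) :
    ∃ a : ℕ → B.PathSpace, Tendsto a atTop (𝓝 x) ∧ ∀ n, a n ∈ D.Z j ∧
      ∃ m, B.rng ((a n).edge m) = B.rng (x.edge m) ∧ (a n).edge m ≠ x.edge m := by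
  choose a ha hax hm using exists_near (D := D) hB hx
  refine ⟨a, PathSpace.tendsto_nhds_iff.mpr fun i => ?_, fun n => ⟨ha n, hm n⟩⟩
  filter_upwards [eventually_gt_atTop i] with n hn
  exact hax n i hn

end FamilyA

/-! ### Invariance of the components under a Vershik map -/

namespace EdgeOrdering.IsVershikMap

variable {ω : B.EdgeOrdering} {φ : B.PathSpace ≃ₜ B.PathSpace}
  {k s : ℕ} {D : B.FamilyA k s}

theorem tailEquiv (hφ : ω.IsVershikMap φ) {x : B.PathSpace} (hx : x ∉ ω.maxPaths) : TailEquiv x (φ x) := by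
  classical
  have h : ∃ m, ¬ ω.IsMaxEdge (x.edge m) := by simpa [maxPaths] using hx
  refine ⟨Nat.find h + 1, fun n hn => ((hφ.apply_of_not_max x (Nat.find h) (fun i hi => ?_)
    (Nat.find_spec h)).2.2 n hn).symm⟩
  exact not_not.mp (Nat.find_min h hi)

/-- Off the maximal paths `φ` preserves tails. A maximal path is a limit of paths of the same
component with a competing edge; these are not maximal, since a maximal edge is determined by its
range, and `Z j` is closed. -/
theorem mem_Z (hφ : ω.IsVershikMap φ) (hB : B.Aperiodic) {x : B.PathSpace} {j : Fin k} (hx : x ∈ D.Z j) :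
    φ x ∈ D.Z j := by
  by_cases hmax : x ∈ ω.maxPaths
  · obtain ⟨a, ha, haZ⟩ := FamilyA.exists_seq_near hB hx
    refine FamilyA.mem_Z_of_tendsto ((φ.continuous.tendsto x).comp ha) fun n => ?_
    obtain ⟨hn, m, hr, hne⟩ := haZ n
    exact FamilyA.mem_Z_of_tailEquiv
      (hφ.tailEquiv fun h => hne (ω.eq_of_isMaxEdge (h m) (hmax m) hr)) hn
  · exact FamilyA.mem_Z_of_tailEquiv (hφ.tailEquiv hmax) hx

theorem symm_mem_Z_of_notMem (hφ : ω.IsVershikMap φ) {y : B.PathSpace} {j : Fin k}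
    (hy : y ∈ D.Z j)
    (hmin : y ∉ ω.minPaths) : φ.symm y ∈ D.Z j := by
  have h : φ.symm y ∉ ω.maxPaths := fun h => hmin <| by
    rw [← hφ.image_maxPaths]
    exact ⟨_, h, φ.apply_symm_apply y⟩
  obtain ⟨N, hN⟩ := hφ.tailEquiv h
  refine FamilyA.mem_Z_of_tailEquiv ⟨N, fun n hn => ?_⟩ hy
  rw [hN n hn, φ.apply_symm_apply]

theorem mem_Z_of_apply (hφ : ω.IsVershikMap φ) (hB : B.Aperiodic) {x : B.PathSpace}
    {j : Fin k} (hx : φ x ∈ D.Z j) :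
    x ∈ D.Z j := by
  rw [← φ.symm_apply_apply x]
  by_cases hmin : φ x ∈ ω.minPaths
  · obtain ⟨a, ha, haZ⟩ := FamilyA.exists_seq_near hB hx
    refine FamilyA.mem_Z_of_tendsto ((φ.symm.continuous.tendsto _).comp ha) fun n => ?_
    obtain ⟨hn, m, hr, hne⟩ := haZ n
    exact hφ.symm_mem_Z_of_notMem hn fun h => hne (ω.eq_of_isMinEdge (h m) (hmin m) hr)
  · exact hφ.symm_mem_Z_of_notMem hx hmin

end EdgeOrdering.IsVershikMap

/-! ### Limits of extremal finite paths along an ultrafilter -/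

namespace FamilyA

variable {k s : ℕ} (D : B.FamilyA k s)

/-- `x` is the limit, along `W`, of the finite paths with edges in `Q` that end at the vertices
with label `t`. -/
def IsLabelLimit (W : Filter ℕ) (Q : ∀ n, B.E n → Prop)
    (t : ((i : Fin k) × Fin (D.d i)) ⊕ Fin s) (x : B.PathSpace) : Prop :=
  ∀ i, ∀ᶠ n in W, ∀ y : B.PathSpace, D.label n (B.src (y.edge (n + 1))) = t →
    (∀ l, l < n + 1 → Q l (y.edge l)) → y.edge i = x.edge i

/-- There is a finite path with edges in `Q` to every vertex. -/
theorem exists_path_to_label {Q : ∀ n, B.E n → Prop}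
    (hQ : ∀ n (v : B.V (n + 1)), ∃ e : B.E n, B.rng e = v ∧ Q n e)
    (t : ((i : Fin k) × Fin (D.d i)) ⊕ Fin s) (n : ℕ) :
    ∃ y : B.PathSpace, D.label n (B.src (y.edge (n + 1))) = t ∧
      ∀ l, l < n + 1 → Q l (y.edge l) := by
  obtain ⟨e, he⟩ := B.src_surjective (n + 1) ((D.label n).symm t)
  obtain ⟨y, hy, hyQ⟩ := exists_path_through Q hQ (n + 1) e
  exact ⟨y, by rw [hy, he, Equiv.apply_symm_apply], hyQ⟩

theorem exists_isLabelLimit {W : Ultrafilter ℕ} (hW : (W : Filter ℕ) ≤ atTop)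
    {Q : ∀ n, B.E n → Prop} (hQ : ∀ n (v : B.V (n + 1)), ∃ e : B.E n, B.rng e = v ∧ Q n e)
    (hQ' : ∀ n (e f : B.E n), Q n e → Q n f → B.rng e = B.rng f → e = f)
    (t : ((i : Fin k) × Fin (D.d i)) ⊕ Fin s) : ∃ x, D.IsLabelLimit W Q t x := by
  choose y hyt hyQ using D.exists_path_to_label hQ t
  obtain ⟨x, hx⟩ := PathSpace.exists_limit W y
  refine ⟨x, fun i => ?_⟩
  filter_upwards [hx i, hW (eventually_ge_atTop i)] with n hn hi y' hyt' hyQ'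
  rw [← hn]
  refine edge_eq_of_meet Q hQ' (n + 1) y' (y n) ?_ hyQ' (hyQ n) i (Nat.lt_succ_of_le hi)
  exact (D.label n).injective (hyt'.trans (hyt n).symm)

variable {D}

theorem IsLabelLimit.mem_Z {W : Filter ℕ} [W.NeBot] {Q : ∀ n, B.E n → Prop}
    (hQ : ∀ n (v : B.V (n + 1)), ∃ e : B.E n, B.rng e = v ∧ Q n e)
    {t : ((i : Fin k) × Fin (D.d i)) ⊕ Fin s} {x : B.PathSpace} (hx : D.IsLabelLimit W Q t x)
    {j : Fin k} (h : ∀ m, ∀ᶠ n in W, ∀ y : B.PathSpace,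
      D.label n (B.src (y.edge (n + 1))) = t → (∀ l, l < n + 1 → Q l (y.edge l)) →
        D.comp m (B.src (y.edge (m + 1))) = some j) : x ∈ D.Z j := fun m => by
  obtain ⟨n, h₁, h₂⟩ := ((hx (m + 1)).and (h m)).exists
  obtain ⟨y, hyt, hyQ⟩ := D.exists_path_to_label hQ t n
  rw [← h₁ y hyt hyQ]
  exact h₂ y hyt hyQ

theorem IsLabelLimit.mem_Z_of_inl {W : Filter ℕ} [W.NeBot] (hW : W ≤ atTop)
    {Q : ∀ n, B.E n → Prop} (hQ : ∀ n (v : B.V (n + 1)), ∃ e : B.E n, B.rng e = v ∧ Q n e)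
    {p : (i : Fin k) × Fin (D.d i)} {x : B.PathSpace} (hx : D.IsLabelLimit W Q (Sum.inl p) x) :
    x ∈ D.Z p.1 := by
  refine hx.mem_Z hQ fun m => ?_
  filter_upwards [hW (eventually_ge_atTop m)] with n hn y hy _
  exact comp_of_le hn (by simp [comp, hy])

/-- If the `Q`-edges into the vertices with a given label start in the `j`-th component, then so
do the `Q`-paths to the limit one level up. -/
theorem IsLabelLimit.mem_Z_of_first {W : Filter ℕ} [W.NeBot] (hW : W ≤ atTop)
    {Q : ∀ n, B.E n → Prop} (hQ : ∀ n (v : B.V (n + 1)), ∃ e : B.E n, B.rng e = v ∧ Q n e)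
    {t : ((i : Fin k) × Fin (D.d i)) ⊕ Fin s} {x : B.PathSpace}
    (hx : D.IsLabelLimit (W.map Nat.succ) Q t x) {j : Fin k}
    (h : ∀ᶠ n in W, ∀ e : B.E (n + 1), Q (n + 1) e → D.label (n + 1) (B.rng e) = t →
      D.comp n (B.src e) = some j) : x ∈ D.Z j := by
  refine hx.mem_Z hQ fun m => ?_
  rw [eventually_map]
  filter_upwards [h, hW (eventually_ge_atTop m)] with n hn hm y hy hyQ
  exact comp_of_le hm (hn _ (hyQ (n + 1) (by omega)) (by rw [y.rng_edge]; exact hy))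

end FamilyA

/-! ### Words of the bottom vertices -/

namespace EdgeOrdering.IsVershikMap

variable {ω : B.EdgeOrdering} {φ : B.PathSpace ≃ₜ B.PathSpace} {k s : ℕ} {D : B.FamilyA k s}

/-- At almost all levels, the Vershik map sends the maximal limit path of a vertex to the minimal
limit path of every vertex that follows it in the ordering. -/
theorem eventually_apply_limit (hφ : ω.IsVershikMap φ) {W : Ultrafilter ℕ}
    {M m : ((i : Fin k) × Fin (D.d i)) ⊕ Fin s → B.PathSpace}
    (hM : ∀ t, D.IsLabelLimit W (fun _ => ω.IsMaxEdge) t (M t))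
    (hm : ∀ t, D.IsLabelLimit W (fun _ => ω.IsMinEdge) t (m t)) :
    ∀ᶠ n in (W : Filter ℕ), ∀ e f : B.E (n + 1), ω.IsSuccEdge e f →
      φ (M (D.label n (B.src e))) = m (D.label n (B.src f)) := by
  suffices H : ∀ t t', ∀ᶠ n in (W : Filter ℕ), ∀ e f : B.E (n + 1), ω.IsSuccEdge e f →
      D.label n (B.src e) = t → D.label n (B.src f) = t' → φ (M t) = m t' by
    filter_upwards [eventually_all.mpr fun t => eventually_all.mpr (H t)] with n hn e f hef
    exact hn _ _ e f hef rfl rfl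
  intro t t'
  by_contra hcon
  -- For an ultrafilter, failing to hold almost everywhere means failing almost everywhere.
  rw [← Ultrafilter.eventually_not] at hcon
  have hne : φ (M t) ≠ m t' := fun h => by
    obtain ⟨n, hn⟩ := hcon.exists
    exact hn fun _ _ _ _ _ => h
  have hy (n : ℕ) : ∃ y : B.PathSpace, (¬ ∀ e f : B.E (n + 1), ω.IsSuccEdge e f →
      D.label n (B.src e) = t → D.label n (B.src f) = t' → φ (M t) = m t') →
      (D.label n (B.src (y.edge (n + 1))) = t ∧ ∀ l, l < n + 1 → ω.IsMaxEdge (y.edge l)) ∧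
      D.label n (B.src ((φ y).edge (n + 1))) = t' ∧
        ∀ l, l < n + 1 → ω.IsMinEdge ((φ y).edge l) := by
    by_cases h : ∀ e f : B.E (n + 1), ω.IsSuccEdge e f →
      D.label n (B.src e) = t → D.label n (B.src f) = t' → φ (M t) = m t'
    · exact ⟨M t, fun h' => absurd h h'⟩
    · push Not at h
      obtain ⟨e, f, hef, he, hf, -⟩ := h
      -- A path that is maximal up to `e` is sent to one that is minimal up to `f`; these paths tend
      -- to `M t` and their images to `m t'`.
      obtain ⟨y, rfl, hyQ⟩ :=
        exists_path_through (fun _ => ω.IsMaxEdge) ω.exists_isMaxEdge (n + 1) e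
      obtain ⟨h₁, h₂, -⟩ := hφ.apply_of_not_max y (n + 1) hyQ (hef.not_isMaxEdge ω)
      refine ⟨y, fun _ => ⟨⟨he, hyQ⟩, ?_, h₁⟩⟩
      rw [h₂.right_unique ω hef, hf]
  choose y hy using hy
  have hlim : Tendsto y W (𝓝 (M t)) := PathSpace.tendsto_nhds_iff.mpr fun i => by
    filter_upwards [hM t i, hcon] with n hn hc
    exact hn _ (hy n hc).1.1 (hy n hc).1.2
  refine hne (PathSpace.ext_edge fun i => ?_)
  obtain ⟨n, h₁, h₂, h₃⟩ := ((PathSpace.tendsto_nhds_iff.mp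
    ((φ.continuous.tendsto _).comp hlim) i).and ((hm t' i).and hcon)).exists
  exact h₁.symm.trans (h₂ _ (hy n h₃).2.1 (hy n h₃).2.2)

/-- If no maximal limit path of a bottom vertex lies in the `j`-th component, then at almost all
levels the first edge into every bottom vertex starts in the `j`-th component. -/
theorem eventually_comp_first (hφ : ω.IsVershikMap φ) (hB : B.Aperiodic) {W : Ultrafilter ℕ}
    (hW : (W : Filter ℕ) ≤ atTop) {M m : ((i : Fin k) × Fin (D.d i)) ⊕ Fin s → B.PathSpace}
    (hM : ∀ t, D.IsLabelLimit W (fun _ => ω.IsMaxEdge) t (M t))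
    (hm : ∀ t, D.IsLabelLimit W (fun _ => ω.IsMinEdge) t (m t)) {j : Fin k}
    (hj : ∀ c, M (Sum.inr c) ∉ D.Z j) :
    ∀ᶠ n in (W : Filter ℕ), ∀ e : B.E (n + 1), ω.IsMinEdge e →
      ∀ c, D.label (n + 1) (B.rng e) = Sum.inr c → D.comp n (B.src e) = some j := by
  filter_upwards [hφ.eventually_apply_limit hM hm] with n hn e he c hc
  by_contra hne
  obtain ⟨f, hfr, hf⟩ := D.exists_edge_of_bottom_of_comp hc j
  -- A word that does not begin in component `j` can never enter it, although positivity of `B_n`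
  -- forces it to.
  refine ω.succ_induction (P := fun f => D.comp n (B.src f) ≠ some j) hne
    (fun g f _ hgf hg hf => ?_) (he f hfr) hf
  have hgf := hn g f hgf
  have hmf : m (D.label n (B.src f)) ∈ D.Z j := by
    unfold FamilyA.comp at hf
    generalize D.label n (B.src f) = t at hf ⊢
    rcases t with p | c
    · obtain rfl : p.1 = j := by simpa using hf
      exact (hm _).mem_Z_of_inl hW ω.exists_isMinEdge
    · simp at hf
  rw [← hgf] at hmf
  have hMg := hφ.mem_Z_of_apply hB hmf
  unfold FamilyA.comp at hg
  generalize D.label n (B.src g) = t at hg hMg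
  rcases t with p | c
  · exact hg (congrArg some
      (FamilyA.Z_disjoint ((hM _).mem_Z_of_inl hW ω.exists_isMaxEdge) hMg))
  · exact hj c hMg

/-- A letter whose maximal limit path lies in a component that contains no minimal limit path of
a bottom vertex is followed by a letter of that component. -/
theorem eventually_comp_succ (hφ : ω.IsVershikMap φ) (hB : B.Aperiodic) {W : Ultrafilter ℕ}
    (hW : (W : Filter ℕ) ≤ atTop) {M m : ((i : Fin k) × Fin (D.d i)) ⊕ Fin s → B.PathSpace}
    (hM : ∀ t, D.IsLabelLimit W (fun _ => ω.IsMaxEdge) t (M t))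
    (hm : ∀ t, D.IsLabelLimit W (fun _ => ω.IsMinEdge) t (m t)) {j₀ : Fin k}
    (hj₀ : ∀ c, m (Sum.inr c) ∈ D.Z j₀) :
    ∀ᶠ n in (W : Filter ℕ), ∀ e f : B.E (n + 1), ω.IsSuccEdge e f → ∀ j, j ≠ j₀ →
      M (D.label n (B.src e)) ∈ D.Z j → D.comp n (B.src f) = some j := by
  filter_upwards [hφ.eventually_apply_limit hM hm] with n hn e f hef j hj he
  have hmf := hφ.mem_Z hB he
  rw [hn e f hef] at hmf
  unfold FamilyA.comp
  generalize D.label n (B.src f) = t at hmf ⊢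
  rcases t with p | c
  · exact congrArg some (FamilyA.Z_disjoint ((hm _).mem_Z_of_inl hW ω.exists_isMinEdge) hmf)
  · exact absurd (FamilyA.Z_disjoint hmf (hj₀ c)) hj

theorem mem_Z_of_comp {W : Ultrafilter ℕ} (hW : (W : Filter ℕ) ≤ atTop)
    {M : ((i : Fin k) × Fin (D.d i)) ⊕ Fin s → B.PathSpace}
    (hM : ∀ t, D.IsLabelLimit W (fun _ => ω.IsMaxEdge) t (M t)) {n : ℕ} {v : B.V (n + 1)}
    {j : Fin k} (h : D.comp n v = some j) : M (D.label n v) ∈ D.Z j := by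
  unfold FamilyA.comp at h
  generalize D.label n v = t at h ⊢
  rcases t with p | c
  · obtain rfl : p.1 = j := by simpa using h
    exact (hM _).mem_Z_of_inl hW ω.exists_isMaxEdge
  · simp at h

/-- The letters after a letter of a component other than `j₀` are in the same component. -/
theorem eventually_comp_of_le (hφ : ω.IsVershikMap φ) (hB : B.Aperiodic) {W : Ultrafilter ℕ}
    (hW : (W : Filter ℕ) ≤ atTop) {M m : ((i : Fin k) × Fin (D.d i)) ⊕ Fin s → B.PathSpace}
    (hM : ∀ t, D.IsLabelLimit W (fun _ => ω.IsMaxEdge) t (M t))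
    (hm : ∀ t, D.IsLabelLimit W (fun _ => ω.IsMinEdge) t (m t)) {j₀ : Fin k}
    (hj₀ : ∀ c, m (Sum.inr c) ∈ D.Z j₀) :
    ∀ᶠ n in (W : Filter ℕ), ∀ e f : B.E (n + 1), ω.le e f → ∀ j, j ≠ j₀ →
      D.comp n (B.src e) = some j → D.comp n (B.src f) = some j := by
  filter_upwards [hφ.eventually_comp_succ hB hW hM hm hj₀] with n hn e f hef j hj he
  exact ω.succ_induction (P := fun f => D.comp n (B.src f) = some j) he
    (fun g f _ hgf hg => hn g f hgf j hj (mem_Z_of_comp hW hM hg)) hef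

theorem exists_limits {W : Ultrafilter ℕ} (hW : (W : Filter ℕ) ≤ atTop) :
    ∃ M m : ((i : Fin k) × Fin (D.d i)) ⊕ Fin s → B.PathSpace,
      (∀ t, D.IsLabelLimit W (fun _ => ω.IsMaxEdge) t (M t)) ∧
      ∀ t, D.IsLabelLimit W (fun _ => ω.IsMinEdge) t (m t) := by
  choose M hM using D.exists_isLabelLimit hW ω.exists_isMaxEdge
    fun n e f he hf h => ω.eq_of_isMaxEdge he hf h
  choose m hm using D.exists_isLabelLimit hW ω.exists_isMinEdge
    fun n e f he hf h => ω.eq_of_isMinEdge he hf h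
  exact ⟨M, m, hM, hm⟩

/-- With fewer bottom vertices than components, the minimal limit paths of all bottom vertices
lie in the same component. -/
theorem exists_component (hφ : ω.IsVershikMap φ) (hB : B.Aperiodic) (hsk : s < k)
    {U : Ultrafilter ℕ} (hU : (U : Filter ℕ) ≤ atTop)
    {m : ((i : Fin k) × Fin (D.d i)) ⊕ Fin s → B.PathSpace}
    (hm : ∀ t, D.IsLabelLimit (U.map Nat.succ) (fun _ => ω.IsMinEdge) t (m t)) :
    ∃ j₀, ∀ c, m (Sum.inr c) ∈ D.Z j₀ := by
  obtain ⟨M', m', hM', hm'⟩ := exists_limits (ω := ω) (D := D) hU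
  -- Pigeonhole: the sets `Z j` are disjoint and `s < k`.
  obtain ⟨j₀, hj₀⟩ : ∃ j₀, ∀ c, M' (Sum.inr c) ∉ D.Z j₀ := by
    by_contra! hcon
    choose c hc using hcon
    have hinj : Function.Injective c := fun i j hij =>
      FamilyA.Z_disjoint (hc i) (by rw [hij]; exact hc j)
    have := Fintype.card_le_of_injective c hinj
    simp only [Fintype.card_fin] at this
    omega
  refine ⟨j₀, fun c => (hm (Sum.inr c)).mem_Z_of_first hU ω.exists_isMinEdge ?_⟩
  filter_upwards [hφ.eventually_comp_first hB hU hM' hm' hj₀] with n hn e he hc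
  exact hn e he c hc

theorem le_two (hφ : ω.IsVershikMap φ) (hB : B.Aperiodic) (D : B.FamilyA k s) (hs : 1 ≤ s)
    (hsk : s < k) : k ≤ 2 := by
  by_contra! hk
  let U : Ultrafilter ℕ := Ultrafilter.of atTop
  have hU : (U : Filter ℕ) ≤ atTop := Ultrafilter.of_le atTop
  -- The shift is needed because limits along `U` control the first edges into the next level, hence
  -- the minimal limits along `U.map Nat.succ`.
  have hW : ((U.map Nat.succ : Ultrafilter ℕ) : Filter ℕ) ≤ atTop :=
    (map_mono hU).trans (tendsto_add_atTop_nat 1)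
  obtain ⟨M, m, hM, hm⟩ := exists_limits (ω := ω) (D := D) hW
  obtain ⟨j₀, hj₀⟩ := hφ.exists_component hB hsk hU hm
  obtain ⟨n, hn⟩ := (hφ.eventually_comp_of_le hB hW hM hm hj₀).exists
  obtain ⟨i, hi⟩ : ∃ i, i ∉ ({j₀} : Finset (Fin k)) := by
    by_contra! h
    have := Finset.card_le_card fun i (_ : i ∈ Finset.univ) => h i
    simp at this
    omega
  obtain ⟨j, hj⟩ : ∃ j, j ∉ ({i, j₀} : Finset (Fin k)) := by
    by_contra! h
    have := (Finset.card_le_card fun i (_ : i ∈ Finset.univ) => h i).trans Finset.card_le_two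
    simp at this
    omega
  simp only [Finset.mem_singleton, Finset.mem_insert, not_or] at hi hj
  have hv : D.label (n + 1) ((D.label (n + 1)).symm (Sum.inr ⟨0, hs⟩)) = Sum.inr ⟨0, hs⟩ :=
    Equiv.apply_symm_apply ..
  obtain ⟨e, her, he⟩ := D.exists_edge_of_bottom_of_comp hv i
  obtain ⟨f, hfr, hf⟩ := D.exists_edge_of_bottom_of_comp hv j
  -- Whichever of the two letters comes first excludes the other after it.
  rcases (ω.comparable_iff e f).mpr (her.trans hfr.symm) with h | h
  · exact hj.1 (Option.some_injective _ (hf.symm.trans (hn e f h i hi he)))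
  · exact hj.1 (Option.some_injective _ ((hn f e h j hj.2 hf).symm.trans he))

/-- With two components and one bottom vertex, at almost all levels there is only one edge between
consecutive bottom vertices. -/
theorem eventually_bottom_edge_unique (hφ : ω.IsVershikMap φ) (hB : B.Aperiodic)
    (D : B.FamilyA 2 1) {U : Ultrafilter ℕ} (hU : (U : Filter ℕ) ≤ atTop) :
    ∀ᶠ n in ((U.map Nat.succ : Ultrafilter ℕ) : Filter ℕ), ∀ e f : B.E (n + 1),
      B.rng e = B.rng f → D.label (n + 1) (B.rng e) = Sum.inr 0 →
      D.label n (B.src e) = Sum.inr 0 → D.label n (B.src f) = Sum.inr 0 → e = f := by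
  have hW : ((U.map Nat.succ : Ultrafilter ℕ) : Filter ℕ) ≤ atTop :=
    (map_mono hU).trans (tendsto_add_atTop_nat 1)
  obtain ⟨M, m, hM, hm⟩ := exists_limits (ω := ω) (D := D) hW
  obtain ⟨j₀, hj₀⟩ := hφ.exists_component hB one_lt_two hU hm
  obtain ⟨j₁, hj⟩ := exists_ne j₀
  have hle := hφ.eventually_comp_of_le hB hW hM hm hj₀
  -- Otherwise the bottom word would begin in component `j₁`, hence remain there and miss `j₀`.
  have hM₁ : M (Sum.inr 0) ∈ D.Z j₁ := by
    by_contra hnot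
    obtain ⟨n, h₁, h₂⟩ := (hle.and (hφ.eventually_comp_first hB hW hM hm (j := j₁)
      fun c => by rwa [Subsingleton.elim c 0])).exists
    have hv : D.label (n + 1) ((D.label (n + 1)).symm (Sum.inr 0)) = Sum.inr 0 :=
      Equiv.apply_symm_apply ..
    obtain ⟨e, her, he⟩ := ω.exists_isMinEdge (n + 1) ((D.label (n + 1)).symm (Sum.inr 0))
    obtain ⟨f, hfr, hf⟩ := D.exists_edge_of_bottom_of_comp hv j₀
    have hej := h₂ e he 0 (by rw [her, hv])
    have := h₁ e f (he f (hfr.trans her.symm)) j₁ hj hej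
    exact hj (Option.some_injective _ (this.symm.trans hf))
  filter_upwards [hφ.eventually_comp_succ hB hW hM hm hj₀] with n hn
  have key (e f : B.E (n + 1)) (hef : ω.le e f) (he : D.label n (B.src e) = Sum.inr 0)
      (hf : D.label n (B.src f) = Sum.inr 0) : f = e := by
    have := ω.succ_induction (P := fun f => f = e ∨ D.comp n (B.src f) = some j₁) (Or.inl rfl)
      (fun g f _ hgf hg => Or.inr (hn g f hgf j₁ hj (hg.elim (fun h => by rwa [h, he])
        (mem_Z_of_comp hW hM)))) hef
    refine this.resolve_right fun h => ?_
    simp [FamilyA.comp, hf] at h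
  intro e f hr _ he hf
  exact ((ω.comparable_iff e f).mpr hr).elim (fun h => (key e f h he hf).symm)
    (fun h => key f e h hf he)

theorem eventually_blockC_eq_one (hφ : ω.IsVershikMap φ) (hB : B.Aperiodic)
    (D : B.FamilyA 2 1) : ∀ᶠ n in atTop, D.blockC n = 1 := by
  suffices H : ∀ᶠ n in atTop, D.blockC (n + 1) = 1 by
    obtain ⟨N, hN⟩ := eventually_atTop.mp H
    refine eventually_atTop.mpr ⟨N + 1, fun n hn => ?_⟩
    obtain ⟨n, rfl⟩ : ∃ l, n = l + 1 := ⟨n - 1, by omega⟩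
    exact hN n (by omega)
  -- A property holding along every ultrafilter finer than `atTop` holds at all but finitely many
  -- levels.
  refine mem_iff_ultrafilter.mpr fun U hU => ?_
  have h := hφ.eventually_bottom_edge_unique hB D hU
  rw [Ultrafilter.coe_map, eventually_map] at h
  filter_upwards [h] with n hn
  ext c c'
  obtain rfl := Subsingleton.elim c 0
  obtain rfl := Subsingleton.elim c' 0
  rw [Matrix.one_apply_eq]
  refine _root_.le_antisymm ?_ (D.blockC_pos ..)
  have hinc := D.incidence_label (n + 1) ((D.label (n + 2)).symm (Sum.inr 0))
    ((D.label (n + 1)).symm (Sum.inr 0))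
  rw [Equiv.apply_symm_apply, Equiv.apply_symm_apply, Matrix.fromBlocks_apply₂₂] at hinc
  rw [← hinc]
  have := B.finite_E (n + 2)
  refine Finite.card_le_one_iff_subsingleton.mpr ⟨fun e f => Subtype.ext ?_⟩
  obtain ⟨e, her, hes⟩ := e
  obtain ⟨f, hfr, hfs⟩ := f
  exact hn e f (her.trans hfr.symm) (by rw [her]; exact Equiv.apply_symm_apply ..)
    (by rw [hes]; exact Equiv.apply_symm_apply ..) (by rw [hfs]; exact Equiv.apply_symm_apply ..)

end EdgeOrdering.IsVershikMap

end BratteliDiagram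

theorem mainTheorem8 (B : BratteliDiagram) (hB : B.Aperiodic) (k s : ℕ) (D : B.FamilyA k s)
    (hs1 : 1 ≤ s) (hsk : s ≤ k - 1) :
    (2 < k → ¬ ∃ ω : B.EdgeOrdering, ω.IsPerfect) ∧
    (k = 2 → (∃ ω : B.EdgeOrdering, ω.IsPerfect) →
      s = 1 ∧ ∃ N : ℕ, ∀ n, N ≤ n → D.blockC n = 1) := by
  refine ⟨?_, ?_⟩
  · rintro hk ⟨ω, φ, hφ⟩
    exact hk.not_ge (hφ.le_two hB D hs1 (by omega))
  · rintro rfl ⟨ω, φ, hφ⟩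
    obtain rfl : s = 1 := by omega
    exact ⟨rfl, Filter.eventually_atTop.mp (hφ.eventually_blockC_eq_one hB D)⟩
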